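/- For a positive integer $t$, let $D(1,t)=G(\mathbb{Z},\{1,t\})$ be the infinite distance graph with vertex set $\mathbb{Z}$ in which two distinct integers $a,b$ are adjacent if and only if $|a-b|\in\{1,t\}$. A packing $k$-coloring of a graph $G$ is a map $f:V(G)\to\{1,2,\dots,k\}$ such that any two distinct vertices of the same color $i$ are at graph distance at least $i+1$, and the packing chromatic number $\chi_\rho(G)$ is the smallest integer $k$ for which $G$ has a packing $k$-coloring ($\infty$ if there is none). For every even integer $t\ge 1$: - if $t\ge 174$, then $\chi_\rho(D(1,t))\le 173$; - if $t\ge 448$, then $\chi_\rho(D(1,t))\le 81$; - if $t\equiv 0$ or $2 \pmod{96}$, then $\chi_\rho(D(1,t))\le 59$. -/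

import Mathlib

/-- The distance graph `G(ℤ, D)`: vertices are the integers, two distinct integers are adjacent
iff the absolute value of their difference belongs to `D`. -/
def distanceGraph (D : Set ℕ) : SimpleGraph ℤ where
  Adj a b := a ≠ b ∧ (a - b).natAbs ∈ D
  symm := ⟨fun a b h => ⟨h.1.symm, by have h2 := h.2; rwa [← Int.natAbs_neg, neg_sub] at h2⟩⟩
  loopless := ⟨fun _ h => h.1 rfl⟩

/-- A packing `k`-coloring of `G`: a map from the vertices to `{1, …, k}` such that any two distinct
vertices of the same color `i` are at distance at least `i + 1`
(vertices in different components are at distance `⊤`). -/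
def IsPackingColoring {V : Type*} (G : SimpleGraph V) (k : ℕ) (f : V → ℕ) : Prop :=
  (∀ v, 1 ≤ f v ∧ f v ≤ k) ∧
    ∀ u v, u ≠ v → f u = f v → ((f u + 1 : ℕ) : ℕ∞) ≤ G.edist u v

/-- The packing chromatic number of `G`: the least `k` for which `G` has a packing `k`-coloring
(`⊤` if there is no such `k`). -/
noncomputable def packingChromaticNumber {V : Type*} (G : SimpleGraph V) : ℕ∞ :=
  ⨅ k ∈ {k : ℕ | ∃ f : V → ℕ, IsPackingColoring G k f}, (k : ℕ∞)

/-!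
Fix a modulus `N ∈ {t - 1, t + 1}` and split `ℤ` into the `N` residue classes modulo `N`, called
*lines*; the integer `n` has position `n / N` on its line. Since `t ≡ ± 1` modulo `N`, a path of
length `L` changes the line by at most `L` steps around the cycle of lines, and a path which returns
to its line moves the position by at most `L / 2`. Hence (`packingChromaticNumber_le_of_lines`) a
colouring is a packing colouring as soon as each colour `c` is used on lines at cyclic distance
greater than `c` only, and within one line at positions `s ≠ s'` with `c < 2 * |s - s'|`.
The task thus becomes one-dimensional: every line is coloured as a path, independently of the
relative position of the other lines.

A line may always be filled by the `P` colours `P, …, 2 * P - 1` repeated periodically. As `t` is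
even, `N` can be chosen of the form `4 * M + 1`. The lines `0, …, 4 * M - 1` repeat the pattern
"colour `1`; colours `2, 3`; colour `1`; free line", and the last line uses `P, …, 2 * P - 1`. It
remains to colour a cyclic sequence of `M` free lines, four steps apart, by colours `≥ 4`
(`IsSpaced`). Six explicit periodic words with the colours `4, …, 23` may be repeated cyclically;
if `M` is not divisible by `6`, two or four further words with colours at most `38` are appended
(`isSpaced_wordLines`) and, for odd `M`, one line with colours `Q, …, 2 * Q - 1` is inserted
(`IsSpaced.insertLine`). The three bounds come from `(Q, P) = (43, 86)`, from `Q = P = 41`, where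
the two full lines are far apart if `t ≥ 448`, and from `P = 30` when `6 ∣ M`.
-/

/-! ### Distances in `D(1, t)` -/

lemma exists_add_mul_of_walk {t : ℕ} {u v : ℤ} (p : (distanceGraph {1, t}).Walk u v) :
    ∃ a b : ℤ, v - u = a + b * t ∧ |a| + |b| ≤ p.length := by
  induction p with
  | nil => exact ⟨0, 0, by simp, by simp⟩
  | @cons u v w h p ih =>
    obtain ⟨a, b, hab, hL⟩ := ih
    have h2 := h.2
    simp only [Set.mem_insert_iff, Set.mem_singleton_iff] at h2
    simp only [SimpleGraph.Walk.length_cons, Nat.cast_add, Nat.cast_one]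
    rcases h2 with h2 | h2
    · rcases (show v - u = 1 ∨ v - u = -1 by omega) with h3 | h3
      · exact ⟨a + 1, b, by linarith, by have := abs_add_le a 1; simp at this; linarith⟩
      · exact ⟨a + -1, b, by linarith, by have := abs_add_le a (-1); simp at this; linarith⟩
    · rcases (show v - u = t ∨ v - u = -t by omega) with h3 | h3
      · exact ⟨a, b + 1, by linarith, by have := abs_add_le b 1; simp at this; linarith⟩
      · exact ⟨a, b + -1, by linarith, by have := abs_add_le b (-1); simp at this; linarith⟩

lemma packingChromaticNumber_le_of_coloring {t k : ℕ} (f : ℤ → ℕ) (hf : ∀ n, 1 ≤ f n ∧ f n ≤ k)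
    (h : ∀ u v, u ≠ v → f u = f v → ∀ a b : ℤ, v - u = a + b * t → (f u : ℤ) < |a| + |b|) :
    packingChromaticNumber (distanceGraph {1, t}) ≤ k := by
  refine iInf₂_le k ⟨f, hf, fun u v huv hc => ?_⟩
  refine le_iInf fun p => ?_
  obtain ⟨a, b, hab, hL⟩ := exists_add_mul_of_walk p
  have := h u v huv hc a b hab
  exact_mod_cast (by omega : f u + 1 ≤ p.length)

/-- `g i s` is the colour at position `s` of line `i`. The last two hypotheses on `g` say that equal
colours `c` on one line are more than `c / 2` positions apart, and that distinct lines sharing the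
colour `c` are more than `c` steps apart in both directions around the cycle of the `N` lines. -/
lemma packingChromaticNumber_le_of_lines {t N K : ℕ} (hN : N = t + 1 ∨ N + 1 = t)
    (g : ℕ → ℤ → ℕ) (hK : K < N) (hg : ∀ i < N, ∀ s, 1 ≤ g i s ∧ g i s ≤ K)
    (hline : ∀ i < N, ∀ s s', s ≠ s' → g i s = g i s' → (g i s : ℤ) < 2 * |s - s'|)
    (hcross : ∀ i j, i < j → j < N → ∀ s s', g i s = g j s' →
      g i s + i < j ∧ g i s + j < N + i) :
    packingChromaticNumber (distanceGraph {1, t}) ≤ K := by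
  have hN0 : (0 : ℤ) < N := by omega
  have hlt : ∀ n : ℤ, (n % N).toNat < N := fun n => by
    have := Int.emod_lt_of_pos n hN0
    have := Int.emod_nonneg n hN0.ne'
    omega
  refine packingChromaticNumber_le_of_coloring (fun n => g (n % N).toNat (n / N))
    (fun n => hg _ (hlt n) _) ?_
  intro u v huv hc a b hab
  by_contra! hL
  have hcK := (hg _ (hlt u) (u / N)).2
  have hu := Int.emod_add_mul_ediv u N
  have hv := Int.emod_add_mul_ediv v N
  have hu1 := hlt u
  have hv1 := hlt v
  obtain ⟨i, hi⟩ : ∃ i : ℕ, u % N = i :=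
    ⟨_, (Int.toNat_of_nonneg (Int.emod_nonneg u hN0.ne')).symm⟩
  obtain ⟨j, hj⟩ : ∃ j : ℕ, v % N = j :=
    ⟨_, (Int.toNat_of_nonneg (Int.emod_nonneg v hN0.ne')).symm⟩
  simp only [hi, hj, Int.toNat_natCast] at hc hL hcK hu hv hu1 hv1
  generalize u / N = s at *
  generalize v / N = s' at *
  -- The line changes by `r = a ± b` modulo `N`, with `|r|` at most the colour.
  obtain ⟨r, hr, hrL, hr0⟩ : ∃ r : ℤ, v - u = r + b * N ∧ |r| ≤ |a| + |b| ∧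
      (r = 0 → |a| + |b| = 2 * |b|) := by
    rcases hN with h | h
    · refine ⟨a - b, by rw [hab, h]; push_cast; ring, abs_sub a b, fun h0 => ?_⟩
      rw [show a = b by linarith]; ring
    · refine ⟨a + b, by rw [hab, ← h]; push_cast; ring, abs_add_le a b, fun h0 => ?_⟩
      rw [show a = -b by linarith, abs_neg]; ring
  have hrc : |r| ≤ g i s := hrL.trans hL
  rw [abs_le] at hrc
  have key : r = j - i + N * (s' - s - b) := by linarith
  generalize hm : s' - s - b = m at key
  rcases lt_trichotomy i j with hij | hij | hij
  · obtain ⟨h1, h2⟩ := hcross i j hij hv1 s s' hc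
    rcases le_or_gt 0 m with hm0 | hm0
    · have := mul_nonneg hN0.le hm0
      omega
    · have : (N : ℤ) * m ≤ N * (-1) := mul_le_mul_of_nonneg_left (by omega) hN0.le
      omega
  · subst hij
    have hm0 : m = 0 := by
      rcases lt_trichotomy m 0 with h | h | h
      · have : (N : ℤ) * m ≤ N * (-1) := mul_le_mul_of_nonneg_left (by omega) hN0.le
        omega
      · exact h
      · have : (N : ℤ) * 1 ≤ N * m := mul_le_mul_of_nonneg_left (by omega) hN0.le
        omega
    have hss : s ≠ s' := by
      rintro rfl
      exact huv (hu.symm.trans hv)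
    have h1 := hline i hu1 s s' hss hc
    have h2 := hr0 (by rw [key, hm0]; ring)
    rw [show s - s' = -b by omega, abs_neg] at h1
    omega
  · obtain ⟨h1, h2⟩ := hcross j i hij hu1 s' s hc.symm
    rw [← hc] at h1 h2
    rcases le_or_gt m 0 with hm0 | hm0
    · have : (N : ℤ) * m ≤ N * 0 := mul_le_mul_of_nonneg_left hm0 hN0.le
      omega
    · have : (N : ℤ) * 1 ≤ N * m := mul_le_mul_of_nonneg_left (by omega) hN0.le
      omega

/-! ### Colourings of a single line -/

/-- The line coloured periodically by `P, P + 1, …, 2 * P - 1`. -/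
def fullLine (P : ℕ) (s : ℤ) : ℕ := P + (s % P).toNat

lemma le_fullLine (P : ℕ) (s : ℤ) : P ≤ fullLine P s := Nat.le_add_right _ _

lemma fullLine_lt {P : ℕ} (hP : 0 < P) (s : ℤ) : fullLine P s < 2 * P := by
  have := Int.emod_lt_of_pos s (Int.natCast_pos.2 hP)
  unfold fullLine
  omega

lemma fullLine_lt_two_mul_abs {P : ℕ} (hP : 0 < P) {s s' : ℤ} (hs : s ≠ s')
    (h : fullLine P s = fullLine P s') : (fullLine P s : ℤ) < 2 * |s - s'| := by
  have hP' := Int.natCast_pos.2 hP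
  have h1 := fullLine_lt hP s
  have hmod : s % P = s' % P := by
    have := Int.emod_nonneg s hP'.ne'
    have := Int.emod_nonneg s' hP'.ne'
    unfold fullLine at h
    omega
  have hdvd : (P : ℤ) ∣ |s - s'| := (dvd_abs _ _).2 (Int.ModEq.dvd hmod.symm)
  have := Int.le_of_dvd (abs_pos.2 (sub_ne_zero.2 hs)) hdvd
  omega

/-- The line coloured by the periodic repetition of the word `l`. -/
def wordLine (l : List ℕ) (s : ℤ) : ℕ := l.getD (s % l.length).toNat 0

/-- The nonempty word `l`, read cyclically, repeats the colour `c` only after more than `c / 2`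
steps. -/
def IsLineWord (l : List ℕ) : Prop :=
  0 < l.length ∧ ∀ i < l.length, ∀ d < l.getD i 0 / 2,
    l.getD ((i + (d + 1)) % l.length) 0 ≠ l.getD i 0

instance (l : List ℕ) : Decidable (IsLineWord l) := by
  unfold IsLineWord
  infer_instance

lemma IsLineWord.wordLine_mem {l : List ℕ} (hl : IsLineWord l) (s : ℤ) : wordLine l s ∈ l := by
  have := Int.emod_lt_of_pos s (Int.natCast_pos.2 hl.1)
  have := Int.emod_nonneg s (Int.natCast_pos.2 hl.1).ne'
  have h : (s % l.length).toNat < l.length := by omega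
  rw [wordLine, List.getD_eq_getElem _ _ h]
  exact List.getElem_mem h

lemma IsLineWord.wordLine_lt_two_mul_abs {l : List ℕ} (hl : IsLineWord l) {s s' : ℤ}
    (hs : s ≠ s') (h : wordLine l s = wordLine l s') :
    (wordLine l s : ℤ) < 2 * |s - s'| := by
  wlog hlt : s < s' generalizing s s'
  · rw [h, abs_sub_comm]
    exact this hs.symm h.symm (lt_of_le_of_ne (not_lt.1 hlt) hs.symm)
  have hL := Int.natCast_pos.2 hl.1
  have h1 := Int.emod_lt_of_pos s hL
  have h0 := Int.emod_nonneg s hL.ne'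
  obtain ⟨d, hd⟩ : ∃ d : ℕ, s' = s + (d + 1 : ℕ) := ⟨(s' - s - 1).toNat, by omega⟩
  rw [show |s - s'| = d + 1 by rw [abs_sub_comm, abs_of_pos (by omega)]; omega]
  by_contra! hc
  refine hl.2 (s % l.length).toNat (by omega) d ?_ ?_
  · change d < wordLine l s / 2
    omega
  · have : (s' % l.length).toNat = ((s % l.length).toNat + (d + 1)) % l.length := by
      have h2 : s' % l.length = (((s % l.length).toNat + (d + 1)) % l.length : ℕ) := by
        rw [hd, Int.natCast_mod, Int.natCast_add (s % l.length).toNat, Int.toNat_of_nonneg h0,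
          Int.emod_add_emod]
      rw [h2, Int.toNat_natCast]
    rw [← this]
    exact h.symm

/-! ### Cyclic sequences of free lines -/

/-- The lines `X 0, …, X (M - 1)` are coloured by colours `≥ 4` so that equal colours `c` on one
line are more than `c / 2` positions apart, and lines sharing the colour `c` are cyclically more
than `c / 4` steps apart. -/
structure IsSpaced (M : ℕ) (X : ℕ → ℤ → ℕ) : Prop where
  four_le : ∀ x < M, ∀ s, 4 ≤ X x s
  line : ∀ x < M, ∀ s s', s ≠ s' → X x s = X x s' → (X x s : ℤ) < 2 * |s - s'|
  cross : ∀ x y, x < y → y < M → ∀ s s', X x s = X y s' →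
    X x s + 4 * x < 4 * y ∧ X x s + 4 * y < 4 * M + 4 * x

/-- The sequence of `4 * M + 1` lines in which the free lines `X` occupy the places congruent to `3`
modulo `4`, the colour `1` the even places, the colours `2` and `3` the remaining ones, and a full
line the last place. -/
def interleave (M P : ℕ) (X : ℕ → ℤ → ℕ) (i : ℕ) : ℤ → ℕ :=
  if i = 4 * M then fullLine P
  else if i % 4 = 3 then X (i / 4)
  else if i % 4 = 1 then fullLine 2
  else fullLine 1

/-- A free line may share colours with the last line only if the two are at least `2 * P` steps
apart. -/
lemma packingChromaticNumber_le_of_isSpaced {t M P : ℕ} (ht : 4 * M = t ∨ 4 * M + 2 = t)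
    {X : ℕ → ℤ → ℕ} (hX : IsSpaced M X) (hP : 4 ≤ P) (hPM : 2 * P ≤ 4 * M + 1)
    (hXP : ∀ x < M, ∀ s, X x s < P ∨
      X x s < 2 * P ∧ 2 * P + 4 * x + 3 ≤ 4 * M ∧ 2 * P ≤ 4 * x + 4) :
    packingChromaticNumber (distanceGraph {1, t}) ≤ ((2 * P - 1 : ℕ) : ℕ∞) := by
  have h1 := fun s => And.intro (le_fullLine 1 s) (fullLine_lt one_pos s)
  have h2 := fun s => And.intro (le_fullLine 2 s) (fullLine_lt two_pos s)
  have h3 := fun s => And.intro (le_fullLine P s) (fullLine_lt (by omega : 0 < P) s)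
  refine packingChromaticNumber_le_of_lines (N := 4 * M + 1) (by omega) (interleave M P X)
    (by omega) ?_ ?_ ?_
  · intro i hi s
    have h1 := h1 s
    have h2 := h2 s
    have h3 := h3 s
    unfold interleave
    split_ifs with c1 c2 c3
    · omega
    · have := hX.four_le (i / 4) (by omega) s
      have := hXP (i / 4) (by omega) s
      omega
    · omega
    · omega
  · intro i hi s s' hs
    unfold interleave
    split_ifs with c1 c2 c3
    · exact fullLine_lt_two_mul_abs (by omega) hs
    · exact hX.line _ (by omega) s s' hs
    · exact fullLine_lt_two_mul_abs two_pos hs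
    · exact fullLine_lt_two_mul_abs one_pos hs
  · intro i j hij hj s s'
    have h1' := h1 s'
    have h2' := h2 s'
    have h3' := h3 s'
    have h1 := h1 s
    have h2 := h2 s
    have h3 := h3 s
    have hi4 : i % 4 = 3 → 4 ≤ X (i / 4) s := fun h => hX.four_le _ (by omega) s
    have hj4 : j ≠ 4 * M → j % 4 = 3 → 4 ≤ X (j / 4) s' :=
      fun _ h => hX.four_le _ (by omega) s'
    have hiP := fun h : i / 4 < M => hXP (i / 4) h s
    have hc := fun h h' => hX.cross (i / 4) (j / 4) h h' s s'
    unfold interleave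
    intro h
    split_ifs at h ⊢ <;> omega

/-- The sequence of lines obtained from `X` by inserting a full line at place `p`. -/
def insertLine (p Q : ℕ) (X : ℕ → ℤ → ℕ) (x : ℕ) : ℤ → ℕ :=
  if x < p then X x else if x = p then fullLine Q else X (x - 1)

lemma IsSpaced.insertLine {M p Q : ℕ} {X : ℕ → ℤ → ℕ} (hX : IsSpaced M X) (hQ : 4 ≤ Q)
    (hp : p ≤ M) (hXQ : ∀ x < M, ∀ s, X x s < Q) : IsSpaced (M + 1) (insertLine p Q X) := by
  refine ⟨fun x hx s => ?_, fun x hx s s' hs => ?_, fun x y hxy hy s s' => ?_⟩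
  · unfold _root_.insertLine
    split_ifs with c1 c2
    · exact hX.four_le x (by omega) s
    · exact hQ.trans (le_fullLine Q s)
    · exact hX.four_le _ (by omega) s
  · unfold _root_.insertLine
    split_ifs with c1 c2
    · exact hX.line x (by omega) s s' hs
    · exact fullLine_lt_two_mul_abs (by omega) hs
    · exact hX.line _ (by omega) s s' hs
  · have hq := le_fullLine Q s
    have hq' := le_fullLine Q s'
    have hx1 := fun h => hXQ x h s
    have hy1 := fun h => hXQ (y - 1) h s'
    have hc1 := fun h h' => hX.cross x y h h' s s'
    have hc2 := fun h h' => hX.cross x (y - 1) h h' s s'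
    have hc3 := fun h h' => hX.cross (x - 1) (y - 1) h h' s s'
    unfold _root_.insertLine
    intro h
    split_ifs at h ⊢ <;> omega

/-! ### The words colouring the free lines -/

/-- Six words with colours `4, …, 23` which may be repeated cyclically. -/
def baseWord : ℕ → List ℕ
  | 0 => [4, 5, 8, 4, 5, 11]
  | 1 => [7, 19, 6, 9, 7, 10, 6, 17, 7, 9, 6, 10]
  | 2 => [5, 4, 16, 5, 4, 18, 5, 4, 22, 5, 4, 20]
  | 3 => [6, 11, 7, 8, 6, 23, 7, 11, 6, 8, 7, 21]
  | 4 => [10, 4, 5, 9, 4, 5]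
  | _ => [15, 14, 6, 7, 12, 13, 6, 7]

/-- Two words which may follow the repetitions of `baseWord`. -/
def twoWords : ℕ → List ℕ
  | 0 => [4, 5, 24, 4, 5, 25, 4, 5, 26, 4, 5, 27, 4, 5, 28]
  | _ => [6, 7, 29, 34, 6, 7, 30, 35, 6, 7, 31, 36, 6, 7, 32, 37, 6, 7, 33, 38]

/-- Four words which may follow the repetitions of `baseWord`. -/
def fourWords : ℕ → List ℕ
  | 0 => [4, 5, 8, 4, 5, 11]
  | 1 => [7, 16, 6, 9, 7, 10, 6, 18, 7, 9, 6, 10]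
  | 2 => [4, 5, 24, 4, 5, 25, 4, 5, 26, 4, 5, 27, 4, 5, 28]
  | _ => [15, 14, 6, 7, 12, 13, 6, 7]

lemma isLineWord_baseWord : ∀ p < 6, IsLineWord (baseWord p) := by decide +kernel

lemma mem_baseWord : ∀ p < 6, ∀ c ∈ baseWord p, 4 ≤ c ∧ c ≤ 23 := by decide +kernel

/-- The right-hand side is four times the cyclic distance from `p` forward to `p'` modulo `6`, which
is taken to be `6` if `p = p'`. -/
lemma lt_of_mem_baseWord : ∀ p < 6, ∀ p' < 6, ∀ c ∈ baseWord p, c ∈ baseWord p' →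
    c < 4 * (if p < p' then p' - p else p' + 6 - p) := by decide +kernel

/-- The words `T 0, …, T (b - 1)` may follow any positive number of repetitions of `baseWord`: they
are valid lines, share no colours among themselves at short distance, and are compatible with the
preceding six words as well as with those following cyclically. The bound `c < 24` in `cross` is
for the way around the cycle, which passes at least six free lines. -/
structure IsTail (b : ℕ) (T : ℕ → List ℕ) : Prop where
  isLineWord : ∀ k < b, IsLineWord (T k)
  mem : ∀ k < b, ∀ c ∈ T k, 4 ≤ c ∧ c ≤ 38
  base : ∀ k < b, ∀ p < 6, ∀ c ∈ T k, c ∈ baseWord p →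
    c < 4 * (6 + k - p) ∧ c < 4 * (b + p - k)
  cross : ∀ k < b, ∀ k' < b, k < k' → ∀ c ∈ T k, c ∈ T k' → c < 4 * (k' - k) ∧ c < 24

lemma isTail_zero (T : ℕ → List ℕ) : IsTail 0 T := by
  constructor <;> intro k hk <;> omega

lemma isTail_two : IsTail 2 twoWords := by
  constructor <;> decide +kernel

lemma isTail_four : IsTail 4 fourWords := by
  constructor <;> decide +kernel

/-- The sequence of `w` repetitions of `baseWord`, followed by the words `T`. -/
def wordSeq (w : ℕ) (T : ℕ → List ℕ) (y : ℕ) : List ℕ :=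
  if y < 6 * w then baseWord (y % 6) else T (y - 6 * w)

lemma IsTail.isLineWord_wordSeq {b : ℕ} {T : ℕ → List ℕ} (hT : IsTail b T) (w : ℕ) {y : ℕ}
    (hy : y < 6 * w + b) : IsLineWord (wordSeq w T y) := by
  unfold wordSeq
  split_ifs with c
  · exact isLineWord_baseWord _ (by omega)
  · exact hT.isLineWord _ (by omega)

lemma IsTail.mem_wordSeq {b : ℕ} {T : ℕ → List ℕ} (hT : IsTail b T) (w : ℕ) {y c : ℕ}
    (hy : y < 6 * w + b) (hc : c ∈ wordSeq w T y) : 4 ≤ c ∧ c ≤ 38 := by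
  unfold wordSeq at hc
  split_ifs at hc
  · have := mem_baseWord _ (by omega) c hc
    omega
  · exact hT.mem _ (by omega) c hc

lemma isSpaced_wordLines {b w : ℕ} {T : ℕ → List ℕ} (hT : IsTail b T) (hw : 0 < w) :
    IsSpaced (6 * w + b) fun y => wordLine (wordSeq w T y) := by
  refine ⟨fun x hx s => ?_, fun x hx s s' hs => ?_, fun x y hxy hy s s' h => ?_⟩
  · exact (hT.mem_wordSeq w hx ((hT.isLineWord_wordSeq w hx).wordLine_mem s)).1
  · exact (hT.isLineWord_wordSeq w hx).wordLine_lt_two_mul_abs hs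
  · have hcx := (hT.isLineWord_wordSeq w (hxy.trans hy)).wordLine_mem s
    have hcy := (hT.isLineWord_wordSeq w hy).wordLine_mem s'
    rw [← h] at hcy
    generalize wordLine (wordSeq w T x) s = c at hcx hcy
    unfold wordSeq at hcx hcy
    split_ifs at hcx hcy with c1 c2 c2
    · have h1 := lt_of_mem_baseWord _ (by omega) _ (by omega) c hcx hcy
      have h2 := lt_of_mem_baseWord _ (by omega) _ (by omega) c hcy hcx
      split_ifs at h1 h2 <;> omega
    · have := hT.base _ (by omega) _ (by omega) c hcy hcx
      omega
    · omega
    · have := hT.cross (x - 6 * w) (by omega) (y - 6 * w) (by omega) (by omega) c hcx hcy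
      omega

/-- Any number `M ≥ 43` of free lines can be coloured by colours less than `Q`, except that the line
at place `36` may need to be a full line. -/
lemma exists_isSpaced {M Q : ℕ} (hM : 43 ≤ M) (hQ : 39 ≤ Q) :
    ∃ X, IsSpaced M X ∧ ∀ x < M, ∀ s, X x s < Q ∨ x = 36 ∧ X x s < 2 * Q := by
  obtain ⟨w, b, T, hT, hw, hM'⟩ : ∃ w b T, IsTail b T ∧ 7 ≤ w ∧
      (M = 6 * w + b ∨ M = 6 * w + b + 1) := by
    rcases (show M % 6 / 2 = 0 ∨ M % 6 / 2 = 1 ∨ M % 6 / 2 = 2 by omega) with h | h | h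
    · exact ⟨M / 6, 0, _, isTail_zero twoWords, by omega, by omega⟩
    · exact ⟨M / 6, 2, _, isTail_two, by omega, by omega⟩
    · exact ⟨M / 6, 4, _, isTail_four, by omega, by omega⟩
  have hX := isSpaced_wordLines hT (by omega : 0 < w)
  have hlt : ∀ y < 6 * w + b, ∀ s, wordLine (wordSeq w T y) s < Q := fun y hy s => by
    have := (hT.mem_wordSeq w hy ((hT.isLineWord_wordSeq w hy).wordLine_mem s)).2
    omega
  rcases hM' with rfl | rfl
  · exact ⟨_, hX, fun x hx s => .inl (hlt x hx s)⟩
  · refine ⟨_, hX.insertLine (p := 36) (Q := Q) (by omega) (by omega) hlt, fun x hx s => ?_⟩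
    unfold insertLine
    split_ifs with c1 c2
    · exact .inl (hlt x (by omega) s)
    · exact .inr ⟨c2, fullLine_lt (by omega) s⟩
    · exact .inl (hlt _ (by omega) s)

/-! ### The bounds -/

/-- In `D(1, 2)` the integers `u` and `v` are at distance at least `|u - v| / 2`; the colouring below
repeats the colour `c` with a period of at least `2 * c + 1`. -/
lemma packingChromaticNumber_one_two_le :
    packingChromaticNumber (distanceGraph {1, 2}) ≤ 15 := by
  refine packingChromaticNumber_le_of_coloring (k := 15) (fun n => (if n % 4 = 0 then 1
    else if n % 8 = 1 then 2 else if n % 8 = 5 then 3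
    else if n % 4 = 2 then 4 + n % 16 / 4 else 8 + n % 32 / 4).toNat) (fun n => ?_) ?_
  · split_ifs <;> omega
  · intro u v huv h a b hab
    have h1 : |v - u| ≤ 2 * (|a| + |b|) := by
      push_cast at hab
      have h2 := abs_add_le a (b * 2)
      rw [abs_mul, abs_two, ← hab] at h2
      linarith [abs_nonneg a]
    have h2 := le_abs_self (v - u)
    have h3 := neg_abs_le (v - u)
    split_ifs at h ⊢ <;> omega

theorem mainTheorem2 (t : ℕ) (ht_pos : 0 < t) (ht_even : Even t) :
    (174 ≤ t → packingChromaticNumber (distanceGraph {1, t}) ≤ 173) ∧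
    (448 ≤ t → packingChromaticNumber (distanceGraph {1, t}) ≤ 81) ∧
    (t ≡ 0 [MOD 96] ∨ t ≡ 2 [MOD 96] →
      packingChromaticNumber (distanceGraph {1, t}) ≤ 59) := by
  obtain ⟨M, hM⟩ : ∃ M, 4 * M = t ∨ 4 * M + 2 = t := by
    obtain ⟨r, rfl⟩ := ht_even
    exact ⟨r / 2, by omega⟩
  refine ⟨fun ht => ?_, fun ht => ?_, fun ht => ?_⟩
  · obtain ⟨X, hX, hlt⟩ := exists_isSpaced (M := M) (Q := 43) (by omega) (by omega)
    refine (packingChromaticNumber_le_of_isSpaced (P := 86) hM hX (by omega) (by omega)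
      fun x hx s => ?_).trans (by norm_cast)
    have := hlt x hx s
    omega
  · obtain ⟨X, hX, hlt⟩ := exists_isSpaced (M := M) (Q := 41) (by omega) (by omega)
    refine packingChromaticNumber_le_of_isSpaced (P := 41) hM hX (by omega) (by omega)
      fun x hx s => ?_
    have := hlt x hx s
    omega
  · simp only [Nat.ModEq] at ht
    by_cases h2 : t = 2
    · subst h2
      exact packingChromaticNumber_one_two_le.trans (by norm_cast)
    obtain ⟨w, rfl⟩ : ∃ w, M = 6 * w := ⟨M / 6, by omega⟩
    refine packingChromaticNumber_le_of_isSpaced (P := 30) hM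
      (isSpaced_wordLines (isTail_zero twoWords) (by omega)) (by omega) (by omega)
      fun x hx s => .inl ?_
    have hmem := (isTail_zero twoWords).isLineWord_wordSeq w hx |>.wordLine_mem s
    generalize wordLine (wordSeq w twoWords x) s = c at hmem ⊢
    rw [wordSeq, if_pos hx] at hmem
    have := mem_baseWord _ (by omega) c hmem
    omega
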